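/- **Setting.** Let $E_{ij}$ be the matrix units of $3\times 3$ complex matrices, $H_1=E_{11}-E_{22}$, $H_2=E_{22}-E_{33}$. The rank one (hyperspecial) current algebra $\mathfrak C\mathfrak g$ of type $A_2^{(2)}$ is the Lie subalgebra of the loop algebra $\mathfrak{sl}_3\otimes\mathbb C[t,t^{-1}]$ generated by $E_{13}\otimes t$, $E_{31}\otimes t^{-1}$ (which generate $\mathfrak g\cong\mathfrak{sl}_2$) and $(E_{21}-E_{32})\otimes 1$. Let $\alpha$ be the positive root of $\mathfrak g$, so $R^-=\{-\alpha\}$, let $\Lambda=\alpha/2$ be its fundamental weight, so $P^+=\{n\Lambda : n\in\mathbb Z_{\ge 0}\}$, let $\delta$ be the indivisible positive imaginary root and $\Lambda_0$ the fundamental weight of the affine node. Put $$\widehat R_{\rm re}(\pm)=\{\pm\alpha+2r\delta : r\ge 0\}\cup\{\tfrac12(\pm\alpha+(2r+1)\delta): r\ge 0\}.$$ The algebra $\mathfrak C\mathfrak g$ has the basis consisting of the vectors, for $r\ge 0$, $$x_{\alpha+2r\delta}=E_{13}\otimes t^{2r+1},\qquad x_{-\alpha+2r\delta}=E_{31}\otimes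 t^{2r-1},$$ $$x_{\frac12(\alpha+(2r+1)\delta)}=E_{12}\otimes t^{r+1}-E_{23}\otimes(-t)^{r+1},\qquad x_{\frac12(-\alpha+(2r+1)\delta)}=E_{21}\otimes t^{r}-E_{32}\otimes(-t)^{r},$$ $$h_{r\delta}=H_1\otimes t^r+H_2\otimes(-t)^r ,$$ where $h_{0}=\alpha^\vee$ spans the Cartan subalgebra of $\mathfrak g$. Let $\mathfrak C\mathfrak n^+$ be the span of the $x_\beta$ with $\beta\in\widehat R_{\rm re}(+)$ and $\mathfrak C\mathfrak h_+$ the span of the $h_{r\delta}$ with $r\ge 1$. For a weight $\mu$ and a real root $\beta$ put $(\mu,\beta^\vee)=2(\mu,\beta)/(\beta,\beta)$, where $(\cdot,\cdot)$ is the standard symmetric bilinear form: $(\alpha,\alpha)=4$, $(\delta,\Lambda_0)=1$, all other pairings of $\alpha,\delta,\Lambda_0$ being $0$. For $\lambda=n\Lambda\in P^+$ the graded local Weyl module is the $\mathfrak C\mathfrak g$-module generated by a vector $w_n$ with the defining relations $$(\mathfrak C\mathfrak n^+\oplus\mathfrak C\mathfrak h_+)\,w_n=0,\qquad h_0\,w_n=n\,w_n,\qquad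 x_{-\alpha}^{\,n+1}w_n=0 .$$ **Proposition 8.6.** Let $n\ge 0$ and $\lambda=n\Lambda\in P^+$. For every $\beta\in\widehat R_{\rm re}(-)\setminus R^-$ the number $k_\beta=\max\{0,-(\lambda+\Lambda_0,\beta^\vee)\}$ is a non-negative integer and $$x_\beta^{\,k_\beta+1}\,w_n=0 .$$ Explicitly, for the roots $\frac12(-\alpha+(2k+1)\delta)=-\frac{\alpha}{2}+(k+\frac12)\delta$, $$x_{-\frac{\alpha}{2}+(k+\frac12)\delta}^{\,2n-2k}\,w_n=0\quad(0\le k\le n-1),\qquad x_{-\frac{\alpha}{2}+(k+\frac12)\delta}\,w_n=0\quad(k\ge n).$$ -/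

import Mathlib

open scoped TensorProduct

noncomputable section

namespace TwistedA22

/-! ### The current algebra inside the loop algebra of `sl₃` -/

/-- The complex Lie algebra `sl₃`. -/
abbrev SL3 : Type := LieAlgebra.SpecialLinear.sl (Fin 3) ℂ

/-- The loop algebra `sl₃ ⊗ ℂ[t, t⁻¹]`. -/
abbrev LoopSL3 : Type := LieAlgebra.loopAlgebra ℂ ℤ SL3

/-- The matrix unit `E_{ij}`, `i ≠ j`, as an element of `sl₃`. -/
def E (i j : Fin 3) (h : i ≠ j) : SL3 := LieAlgebra.SpecialLinear.single i j h 1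

/-- The Chevalley basis vector `X⁺₁₁` (root vector of the first simple root of `sl₃`). -/
def Xp1 : SL3 := E 0 1 (by decide)
/-- The Chevalley basis vector `X⁺₂₂` (root vector of the second simple root of `sl₃`). -/
def Xp2 : SL3 := E 1 2 (by decide)
/-- The Chevalley basis vector `X⁺₁₂` (root vector of the highest root of `sl₃`). -/
def Xp12 : SL3 := E 0 2 (by decide)
/-- The Chevalley basis vector `X⁻₁₁`. -/
def Xm1 : SL3 := E 1 0 (by decide)
/-- The Chevalley basis vector `X⁻₂₂`. -/
def Xm2 : SL3 := E 2 1 (by decide)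
/-- The Chevalley basis vector `X⁻₁₂`. -/
def Xm12 : SL3 := E 2 0 (by decide)
/-- The coroot `H₁ = E₁₁ - E₂₂` of `sl₃`. -/
def H1 : SL3 := LieAlgebra.SpecialLinear.singleSubSingle 0 1 1
/-- The coroot `H₂ = E₂₂ - E₃₃` of `sl₃`. -/
def H2 : SL3 := LieAlgebra.SpecialLinear.singleSubSingle 1 2 1

/-- The element `X ⊗ t^r` of the loop algebra. -/
def loop (r : ℤ) (X : SL3) : LoopSL3 := (AddMonoidAlgebra.single r (1 : ℂ)) ⊗ₜ[ℂ] X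

/-- The subalgebra `𝔤 ≅ sl₂`, generated by `x₁⁺ ⊗ t` and `x₁⁻ ⊗ t⁻¹`, where `x₁^± = X^±₁₂`. -/
def finiteAlgebra : LieSubalgebra ℂ LoopSL3 :=
  LieSubalgebra.lieSpan ℂ LoopSL3 {loop 1 Xp12, loop (-1) Xm12}

/-- The rank one (hyperspecial) current algebra of type `A₂⁽²⁾`: the subalgebra of the loop algebra
generated by `𝔤` and `x₀⁺ = (X⁻₁₁ - X⁻₂₂) ⊗ 1`. -/
def currentAlgebra : LieSubalgebra ℂ LoopSL3 :=
  LieSubalgebra.lieSpan ℂ LoopSL3 ((finiteAlgebra : Set LoopSL3) ∪ {loop 0 (Xm1 - Xm2)})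

/-! ### Affine weights and real roots -/

/-- The weights of the affine Cartan subalgebra with rational coordinates:
`μ 0 • α + μ 1 • δ + μ 2 • Λ₀`. -/
abbrev AffineWeight : Type := Fin 3 → ℚ

/-- The positive root `α` of `𝔤`; it is the simple root `α₁`. -/
def rootα : AffineWeight := ![1, 0, 0]
/-- The indivisible positive imaginary root `δ = 2 α₀ + α₁`. -/
def rootδ : AffineWeight := ![0, 1, 0]
/-- The fundamental weight `Λ₀`: it is `1` on `α₀^∨` and `0` on `α₁^∨` and on the scaling
element `d`. -/
def weightΛ₀ : AffineWeight := ![0, 0, 1]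
/-- The fundamental weight `Λ = α/2` of `𝔤`. -/
def weightΛ : AffineWeight := (1 / 2 : ℚ) • rootα

/-- The standard (normalized) invariant bilinear form of type `A₂⁽²⁾`:
`(α, α) = 4`, `(δ, Λ₀) = 1`, and all other pairings of `α`, `δ`, `Λ₀` vanish. -/
def stdForm (μ ν : AffineWeight) : ℚ := 4 * μ 0 * ν 0 + μ 1 * ν 2 + μ 2 * ν 1

/-- The value `(μ, β^∨) = 2 (μ, β) / (β, β)` of a weight on the coroot of a real root `β`. -/
def corootPairing (μ β : AffineWeight) : ℚ := 2 * stdForm μ β / stdForm β β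

/-- The real roots `β` occurring in the current algebra, that is the elements of
`R̂_re(+) ∪ R̂_re(-)`. -/
inductive RealRoot : Type
  /-- `α + 2rδ` -/
  | posLong (r : ℕ)
  /-- `-α + 2rδ` -/
  | negLong (r : ℕ)
  /-- `½(α + (2r+1)δ)` -/
  | posHalf (r : ℕ)
  /-- `½(-α + (2r+1)δ)` -/
  | negHalf (r : ℕ)

/-- The real root as an affine weight. -/
def RealRoot.weight : RealRoot → AffineWeight
  | .posLong r => rootα + (2 * r : ℚ) • rootδ
  | .negLong r => -rootα + (2 * r : ℚ) • rootδ
  | .posHalf r => (1 / 2 : ℚ) • (rootα + (2 * r + 1 : ℚ) • rootδ)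
  | .negHalf r => (1 / 2 : ℚ) • (-rootα + (2 * r + 1 : ℚ) • rootδ)

/-- `R̂_re(+)`. -/
def posRealRoots : Set AffineWeight :=
  {β | ∃ r : ℕ, β = rootα + (2 * r : ℚ) • rootδ} ∪
    {β | ∃ r : ℕ, β = (1 / 2 : ℚ) • (rootα + (2 * r + 1 : ℚ) • rootδ)}

/-- `R̂_re(-)`. -/
def negRealRoots : Set AffineWeight :=
  {β | ∃ r : ℕ, β = -rootα + (2 * r : ℚ) • rootδ} ∪
    {β | ∃ r : ℕ, β = (1 / 2 : ℚ) • (-rootα + (2 * r + 1 : ℚ) • rootδ)}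

/-- `R⁻`, the negative roots of `𝔤`. -/
def finiteNegRoots : Set AffineWeight := {-rootα}

/-! ### Root vectors -/

/-- The root vectors `x_β`, as elements of the loop algebra. -/
def rootVectorLoop : RealRoot → LoopSL3
  | .posLong r => loop (2 * r + 1) Xp12
  | .negLong r => loop (2 * r - 1) Xm12
  | .posHalf r => loop (r + 1) Xp1 - (-1 : ℂ) ^ (r + 1) • loop (r + 1) Xp2
  | .negHalf r => loop r Xm1 - (-1 : ℂ) ^ r • loop r Xm2

/-- The elements `h_{rδ} = H₁ ⊗ t^r + H₂ ⊗ (-t)^r`, as elements of the loop algebra. -/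
def imagVectorLoop (r : ℕ) : LoopSL3 := loop r H1 + (-1 : ℂ) ^ r • loop r H2

lemma loop_lie (r s : ℤ) (X Y : SL3) : ⁅loop r X, loop s Y⁆ = loop (r + s) ⁅X, Y⁆ := by
  rw [loop, loop, LieAlgebra.ExtendScalars.bracket_tmul, AddMonoidAlgebra.single_mul_single,
    mul_one]
  rfl

lemma loop_add (r : ℤ) (X Y : SL3) : loop r (X + Y) = loop r X + loop r Y := by
  simp [loop, TensorProduct.tmul_add]

lemma loop_smul (r : ℤ) (c : ℂ) (X : SL3) : loop r (c • X) = c • loop r X := by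
  simp [loop, TensorProduct.tmul_smul]

lemma loop_sub (r : ℤ) (X Y : SL3) : loop r (X - Y) = loop r X - loop r Y := by
  simp [loop, TensorProduct.tmul_sub]

lemma rootVectorLoop_posHalf (r : ℕ) :
    rootVectorLoop (.posHalf r) = loop (r + 1) (Xp1 - (-1 : ℂ) ^ (r + 1) • Xp2) := by
  rw [loop_sub, loop_smul]; rfl

lemma rootVectorLoop_negHalf (r : ℕ) :
    rootVectorLoop (.negHalf r) = loop r (Xm1 - (-1 : ℂ) ^ r • Xm2) := by
  rw [loop_sub, loop_smul]; rfl

lemma imagVectorLoop_eq (r : ℕ) :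
    imagVectorLoop r = loop r (H1 + (-1 : ℂ) ^ r • H2) := by
  rw [loop_add, loop_smul]; rfl

lemma sl3_lie {X Y Z : SL3}
    (h : ∀ i j, (X.val * Y.val - Y.val * X.val) i j = Z.val i j) : ⁅X, Y⁆ = Z :=
  Subtype.ext (Matrix.ext h)

lemma lie_Xp12_Xm (a : ℂ) : ⁅Xp12, Xm1 - a • Xm2⁆ = (-1 : ℂ) • (a • Xp1 + Xp2) := by
  apply sl3_lie
  intro i j
  fin_cases i <;> fin_cases j <;>
    simp [Xp12, Xm1, Xm2, Xp1, Xp2, E, Matrix.mul_apply, Matrix.single_apply]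

lemma lie_Xp12_Xm12 : ⁅Xp12, Xm12⁆ = H1 + H2 := by
  apply sl3_lie
  intro i j
  fin_cases i <;> fin_cases j <;>
    simp [Xp12, Xm12, H1, H2, E]

lemma lie_Xp_Xm (a b : ℂ) : ⁅Xp1 + a • Xp2, Xm1 - b • Xm2⁆ = H1 - (a * b) • H2 := by
  apply sl3_lie
  intro i j
  fin_cases i <;> fin_cases j <;>
    simp [Xp1, Xp2, Xm1, Xm2, H1, H2, E, Matrix.mul_apply, Matrix.single_apply] <;> ring

lemma lie_H_Xp (a : ℂ) : ⁅H1 - H2, Xp1 + a • Xp2⁆ = (3 : ℂ) • (Xp1 - a • Xp2) := by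
  apply sl3_lie
  intro i j
  fin_cases i <;> fin_cases j <;>
    simp [Xp1, Xp2, H1, H2, E, Matrix.mul_apply, Matrix.single_apply] <;> ring

lemma lie_H_Xm (a : ℂ) : ⁅H1 - H2, Xm1 + a • Xm2⁆ = (-3 : ℂ) • (Xm1 - a • Xm2) := by
  apply sl3_lie
  intro i j
  fin_cases i <;> fin_cases j <;>
    simp [Xm1, Xm2, H1, H2, E, Matrix.mul_apply, Matrix.single_apply] <;> ring

lemma lie_Xp_Xp (a b : ℂ) : ⁅Xp1 + a • Xp2, Xp1 + b • Xp2⁆ = (b - a) • Xp12 := by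
  apply sl3_lie
  intro i j
  fin_cases i <;> fin_cases j <;>
    simp [Xp1, Xp2, Xp12, E, Matrix.mul_apply, Matrix.single_apply]

lemma lie_Xm_Xm (a b : ℂ) : ⁅Xm1 + a • Xm2, Xm1 + b • Xm2⁆ = (a - b) • Xm12 := by
  apply sl3_lie
  intro i j
  fin_cases i <;> fin_cases j <;>
    simp [Xm1, Xm2, Xm12, E, Matrix.mul_apply, Matrix.single_apply]

lemma loop_mem_of_lie {r s q : ℤ} {X Y Z : SL3} (c : ℂ) (hc : c ≠ 0)
    (hX : loop r X ∈ currentAlgebra) (hY : loop s Y ∈ currentAlgebra)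
    (hq : r + s = q) (hZ : ⁅X, Y⁆ = c • Z) : loop q Z ∈ currentAlgebra := by
  have h := currentAlgebra.lie_mem hX hY
  rw [loop_lie, hZ, loop_smul, hq] at h
  have h2 := currentAlgebra.smul_mem c⁻¹ h
  rwa [smul_smul, inv_mul_cancel₀ hc, one_smul] at h2

lemma loop_Xp12_mem : loop 1 Xp12 ∈ currentAlgebra :=
  LieSubalgebra.subset_lieSpan (Or.inl (LieSubalgebra.subset_lieSpan (Or.inl rfl)))

lemma loop_Xm12_mem : loop (-1) Xm12 ∈ currentAlgebra :=
  LieSubalgebra.subset_lieSpan (Or.inl (LieSubalgebra.subset_lieSpan (Or.inr rfl)))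

lemma loop_Xm_mem : loop 0 (Xm1 - (1 : ℂ) • Xm2) ∈ currentAlgebra := by
  rw [one_smul]
  exact LieSubalgebra.subset_lieSpan (Or.inr rfl)

lemma loop_Xp_mem : loop 1 (Xp1 + (1 : ℂ) • Xp2) ∈ currentAlgebra :=
  loop_mem_of_lie (-1) (by norm_num) loop_Xp12_mem loop_Xm_mem (by norm_num)
    (by rw [lie_Xp12_Xm]; simp)

lemma loop_H_mem : loop 1 (H1 - H2) ∈ currentAlgebra :=
  loop_mem_of_lie 1 (by norm_num) loop_Xp_mem loop_Xm_mem (by norm_num)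
    (by rw [lie_Xp_Xm]; simp)

lemma loop_Xp_pow_mem (r : ℕ) :
    loop (r + 1) (Xp1 + (-1 : ℂ) ^ r • Xp2) ∈ currentAlgebra := by
  induction r with
  | zero => simpa using loop_Xp_mem
  | succ r ih =>
    refine loop_mem_of_lie 3 (by norm_num) loop_H_mem ih (by push_cast; ring) ?_
    rw [lie_H_Xp, pow_succ, mul_neg_one, neg_smul, sub_eq_add_neg]

lemma loop_Xm_pow_mem (r : ℕ) :
    loop r (Xm1 + (-(-1 : ℂ) ^ r) • Xm2) ∈ currentAlgebra := by
  induction r with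
  | zero => simpa [sub_eq_add_neg] using loop_Xm_mem
  | succ r ih =>
    refine loop_mem_of_lie (-3) (by norm_num) loop_H_mem ih (by push_cast; ring) ?_
    rw [lie_H_Xm, pow_succ, mul_neg_one, neg_neg, sub_eq_add_neg, ← neg_smul, neg_neg]

lemma rootVectorLoop_mem (β : RealRoot) : rootVectorLoop β ∈ currentAlgebra := by
  cases β with
  | posLong r =>
    cases r with
    | zero => simpa [rootVectorLoop] using loop_Xp12_mem
    | succ r =>
      refine loop_mem_of_lie (-2) (by norm_num) (loop_Xp_pow_mem 0)
        (loop_Xp_pow_mem (2 * r + 1)) (by push_cast; ring) ?_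
      rw [lie_Xp_Xp, pow_succ, pow_mul]
      norm_num
  | negLong r =>
    cases r with
    | zero => simpa [rootVectorLoop] using loop_Xm12_mem
    | succ r =>
      refine loop_mem_of_lie (-2) (by norm_num) (loop_Xm_pow_mem 0)
        (loop_Xm_pow_mem (2 * r + 1)) (by push_cast; ring) ?_
      rw [lie_Xm_Xm, pow_succ, pow_mul]
      norm_num
  | posHalf r =>
    rw [rootVectorLoop_posHalf, pow_succ, mul_neg_one, neg_smul, sub_neg_eq_add]
    exact loop_Xp_pow_mem r
  | negHalf r =>
    rw [rootVectorLoop_negHalf, sub_eq_add_neg, ← neg_smul]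
    exact loop_Xm_pow_mem r

lemma imagVectorLoop_mem (r : ℕ) : imagVectorLoop r ∈ currentAlgebra := by
  rw [imagVectorLoop_eq]
  cases r with
  | zero =>
    refine loop_mem_of_lie 1 (by norm_num) loop_Xp12_mem loop_Xm12_mem (by norm_num) ?_
    rw [lie_Xp12_Xm12]; simp
  | succ r =>
    refine loop_mem_of_lie 1 (by norm_num) (loop_Xp_pow_mem r) loop_Xm_mem
      (by push_cast; ring) ?_
    rw [lie_Xp_Xm, pow_succ]; simp [sub_eq_add_neg]

/-- The root vector `x_β` of the current algebra. -/
def rootVector (β : RealRoot) : currentAlgebra := ⟨rootVectorLoop β, rootVectorLoop_mem β⟩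

/-- The element `h_{rδ}` of the current algebra; `h_{0δ}` is the coroot `α^∨`, which spans `𝔥`. -/
def imagVector (r : ℕ) : currentAlgebra := ⟨imagVectorLoop r, imagVectorLoop_mem r⟩

/-! ### The graded local Weyl module -/

/-- The subspace `ℭ𝔫⁺` spanned by the `x_β` with `β ∈ R̂_re(+)`. -/
def posPart : Submodule ℂ currentAlgebra :=
  Submodule.span ℂ {x | ∃ β : RealRoot, β.weight ∈ posRealRoots ∧ x = rootVector β}

/-- The subspace `ℭ𝔥₊` spanned by the `h_{rδ}` with `r ≥ 1`. -/
def imagPart : Submodule ℂ currentAlgebra :=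
  Submodule.span ℂ {x | ∃ r : ℕ, 1 ≤ r ∧ x = imagVector r}

/-- The universal enveloping algebra of the current algebra. -/
abbrev U : Type := UniversalEnvelopingAlgebra ℂ currentAlgebra

/-- The canonical map of the current algebra into its universal enveloping algebra. -/
abbrev toU (x : currentAlgebra) : U := UniversalEnvelopingAlgebra.ι ℂ x

/-- The left ideal generated by the defining relations of the graded local Weyl module of highest
weight `nΛ`: `(ℭ𝔫⁺ ⊕ ℭ𝔥₊) w = 0`, `α^∨ w = n w`, `x_{-α}^{n+1} w = 0`. -/
def weylRelations (n : ℕ) : Submodule U U :=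
  Submodule.span U
    ({u | ∃ x ∈ posPart ⊔ imagPart, u = toU x} ∪
      {toU (imagVector 0) - (n : U), toU (rootVector (.negLong 0)) ^ (n + 1)})

/-- The graded local Weyl module of highest weight `nΛ`. -/
abbrev LocalWeyl (n : ℕ) : Type := U ⧸ weylRelations n

/-- The cyclic generator `w_n` of the graded local Weyl module. -/
def weylVector (n : ℕ) : LocalWeyl n := Submodule.Quotient.mk (1 : U)

end TwistedA22

end

namespace TwistedA22

/-! ### Abstract representations of the current algebra -/

/-! Everything follows from one weight estimate, `IsRep.act_eq_zero`: a nonzero vector of weight nΛ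
+ m(α/2) + d(δ/2) obtained from w has (n + m)² + d ≤ n². With Λ₀ added to the weights this says that
no weight is longer than λ + Λ₀ for the standard form. For a root β the vector λ + Λ₀ + pβ with p ≥
1 is longer than λ + Λ₀ exactly when p > -(λ + Λ₀, β^∨), so the power k_β + 1 of x_β must kill w.

The estimate is proved by induction on n. Modulo all f_i w the module is spanned by the Y_0^j w with
j ≤ n, as for sl₂, and these obey the bound (`IsRep.act_mem_span_Y_pow`). It remains to bound the
submodules generated by the f_j w. Here f_j w = 0 for j ≥ n (`IsRep.f_apply_eq_zero`, by a
Garland-type computation of e_0^(2n+1) Y_0^(n+1) w), and modulo the f_i w with i > j the vector f_j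
w satisfies the relations for n - 1 (`IsRep.isHighest_mkQ_f`). A descending induction on j then
applies the bound for n - 1, and the shift 2j + 1 ≤ n² - (n - 1)² is just what the bound for n
allows.

The induction passes through quotients, so it is run for any operators satisfying the commutators in
`Bracket`. Since V carries no grading, it is supplied by families indexed by degrees (`shiftRep`),
where the error terms in a quotient can be separated by degree. -/

/-- Labels of the basis vectors of the current algebra: `X r`, `Y r`, `e r`, `f r`, `h r` stand for
the root vectors of `α + 2rδ`, `-α + 2rδ`, `½(α + (2r+1)δ)`, `½(-α + (2r+1)δ)` and for `h_{rδ}`. -/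
inductive Gen : Type
  | X (r : ℕ)
  | Y (r : ℕ)
  | e (r : ℕ)
  | f (r : ℕ)
  | h (r : ℕ)

/-- The weight in units of `α/2` and the degree in units of `δ/2`. -/
def Gen.deg : Gen → ℤ × ℤ
  | .X r => (2, 4 * r)
  | .Y r => (-2, 4 * r)
  | .e r => (1, 2 * r + 1)
  | .f r => (-1, 2 * r + 1)
  | .h r => (0, 2 * r)

/-- `Bracket x y c z` lists the commutators `[x, y] = c z` that the weight estimate uses. -/
inductive Bracket : Gen → Gen → ℂ → Gen → Prop
  | X_Y (r : ℕ) : Bracket (.X r) (.Y 0) 1 (.h (2 * r))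
  | h_Y_even (r : ℕ) : Bracket (.h (2 * r)) (.Y 0) (-2) (.Y r)
  | h_Y_odd (r : ℕ) : Bracket (.h (2 * r + 1)) (.Y 0) 0 (.Y 0)
  | Y_Y (r : ℕ) : Bracket (.Y r) (.Y 0) 0 (.Y 0)
  | e_Y (r : ℕ) : Bracket (.e r) (.Y 0) ((-1) ^ r) (.f r)
  | f_Y (r : ℕ) : Bracket (.f r) (.Y 0) 0 (.Y 0)
  | f_f (r : ℕ) : Bracket (.f 0) (.f (2 * r + 1)) (-2) (.Y (r + 1))
  | e_f (r s : ℕ) : Bracket (.e r) (.f s) 1 (.h (r + s + 1))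
  | X_f (r s : ℕ) : Bracket (.X r) (.f s) (-(-1) ^ s) (.e (2 * r + s))
  | h_f (r s : ℕ) : Bracket (.h r) (.f s) ((-1) ^ r - 2) (.f (r + s))
  | e_h : Bracket (.e 0) (.h 1) (-3) (.e 1)
  | e_e : Bracket (.e 0) (.e 1) (-2) (.X 1)
  | e_X : Bracket (.e 0) (.X 1) 0 (.X 1)

/-- A vanishing commutator is listed with a placeholder as last label, so additivity of degrees is
available only when c ≠ 0. -/
lemma Bracket.deg_eq {x y z : Gen} {c : ℂ} (b : Bracket x y c z) :
    c = 0 ∨ z.deg = x.deg + y.deg := by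
  cases b <;> first | exact Or.inl rfl | (refine Or.inr ?_; ext <;> simp [Gen.deg] <;> ring)

section Rep

variable {V : Type} [AddCommGroup V] [Module ℂ V]

/-- A family of operators satisfying the listed commutation relations. -/
def IsRep (ρ : Gen → Module.End ℂ V) : Prop :=
  ∀ ⦃x y : Gen⦄ ⦃c : ℂ⦄ ⦃z : Gen⦄, Bracket x y c z →
    ∀ v : V, ρ x (ρ y v) = ρ y (ρ x v) + c • ρ z v

/-- The defining relations of the generator of the local Weyl module of highest weight `nΛ`. -/
structure IsHighest (ρ : Gen → Module.End ℂ V) (n : ℕ) (w : V) : Prop where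
  X_apply : ∀ r, ρ (.X r) w = 0
  e_apply : ∀ r, ρ (.e r) w = 0
  h_apply : ∀ r, ρ (.h (r + 1)) w = 0
  h_zero : ρ (.h 0) w = (n : ℂ) • w
  Y_pow : (ρ (.Y 0) ^ (n + 1)) w = 0

/-- The operator of a word in the generators. -/
def act (ρ : Gen → Module.End ℂ V) (L : List Gen) : Module.End ℂ V := (L.map ρ).prod

/-- The total degree of a word in the generators. -/
def wordDeg (L : List Gen) : ℤ × ℤ := (L.map Gen.deg).sum

@[simp] lemma act_nil (ρ : Gen → Module.End ℂ V) (v : V) : act ρ [] v = v := by simp [act]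

@[simp] lemma act_cons (ρ : Gen → Module.End ℂ V) (x : Gen) (L : List Gen) (v : V) :
    act ρ (x :: L) v = ρ x (act ρ L v) := by simp [act]

lemma act_replicate (ρ : Gen → Module.End ℂ V) (x : Gen) (k : ℕ) :
    act ρ (List.replicate k x) = ρ x ^ k := by simp [act]

@[simp] lemma wordDeg_nil : wordDeg [] = 0 := rfl

@[simp] lemma wordDeg_cons (x : Gen) (L : List Gen) :
    wordDeg (x :: L) = x.deg + wordDeg L := by simp [wordDeg]

lemma wordDeg_replicate (x : Gen) (k : ℕ) : wordDeg (List.replicate k x) = k • x.deg := by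
  simp [wordDeg]

/-! ### Divided powers -/

/-- The divided power `T^j / j!`, zero for negative `j`. -/
noncomputable def divPow (T : Module.End ℂ V) (j : ℤ) : Module.End ℂ V :=
  if 0 ≤ j then ((j.toNat.factorial : ℂ)⁻¹) • T ^ j.toNat else 0

lemma divPow_of_neg (T : Module.End ℂ V) {j : ℤ} (hj : j < 0) : divPow T j = 0 := by
  simp [divPow, hj]

lemma divPow_natCast (T : Module.End ℂ V) (j : ℕ) :
    divPow T j = ((j.factorial : ℂ)⁻¹) • T ^ j := by simp [divPow]

/-- The shift rule holds for every integer j: at j = -1 the factor j + 1 vanishes and absorbs the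
convention for negative indices, so no boundary cases arise later. -/
lemma apply_divPow (T : Module.End ℂ V) (j : ℤ) (v : V) :
    T (divPow T j v) = ((j : ℂ) + 1) • divPow T (j + 1) v := by
  rcases lt_trichotomy j (-1) with h | rfl | h
  · rw [divPow_of_neg T (by lia), divPow_of_neg T (by lia)]; simp
  · rw [divPow_of_neg T (by lia)]; simp
  · obtain ⟨k, rfl⟩ := Int.eq_ofNat_of_zero_le (by lia : 0 ≤ j)
    have hk : (k : ℂ) + 1 ≠ 0 := by exact_mod_cast k.succ_ne_zero
    have hf : (k.factorial : ℂ) ≠ 0 := by exact_mod_cast k.factorial_ne_zero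
    have : ((k : ℤ) + 1) = ((k + 1 : ℕ) : ℤ) := by push_cast; rfl
    rw [this, divPow_natCast, divPow_natCast]
    simp only [LinearMap.smul_apply, map_smul, pow_succ', Module.End.mul_apply, smul_smul,
      Nat.factorial_succ, Nat.cast_mul, Nat.cast_add, Nat.cast_one, Int.cast_natCast]
    congr 1
    field_simp

/-- Leibniz rule for divided powers, with a_i = (ad T)^i a₀ and (ad T)^5 a₀ = 0. The length fits T =
e_0, whose adjoint action runs Y_0, f_0, h_1, -3e_1, 6X_1, 0. -/
lemma divPow_apply_chain (T a₀ a₁ a₂ a₃ a₄ : Module.End ℂ V)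
    (h₀ : ∀ v, T (a₀ v) = a₀ (T v) + a₁ v) (h₁ : ∀ v, T (a₁ v) = a₁ (T v) + a₂ v)
    (h₂ : ∀ v, T (a₂ v) = a₂ (T v) + a₃ v) (h₃ : ∀ v, T (a₃ v) = a₃ (T v) + a₄ v)
    (h₄ : ∀ v, T (a₄ v) = a₄ (T v)) (j : ℕ) (v : V) :
    divPow T j (a₀ v) = a₀ (divPow T j v) + a₁ (divPow T (j - 1) v) +
      (1 / 2 : ℂ) • a₂ (divPow T (j - 2) v) + (1 / 6 : ℂ) • a₃ (divPow T (j - 3) v) +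
      (1 / 24 : ℂ) • a₄ (divPow T (j - 4) v) := by
  induction j with
  | zero =>
    rw [divPow_of_neg T (by lia : ((0 : ℕ) : ℤ) - 1 < 0),
      divPow_of_neg T (by lia : ((0 : ℕ) : ℤ) - 2 < 0),
      divPow_of_neg T (by lia : ((0 : ℕ) : ℤ) - 3 < 0),
      divPow_of_neg T (by lia : ((0 : ℕ) : ℤ) - 4 < 0), divPow_natCast]
    simp
  | succ j ih =>
    have hk : (j : ℂ) + 1 ≠ 0 := by exact_mod_cast j.succ_ne_zero
    have key := congrArg T ih
    simp only [map_add, map_smul, h₀, h₁, h₂, h₃, h₄, apply_divPow] at key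
    rw [show (j : ℤ) - 1 + 1 = j by ring, show (j : ℤ) - 2 + 1 = j - 1 by ring,
      show (j : ℤ) - 3 + 1 = j - 2 by ring, show (j : ℤ) - 4 + 1 = j - 3 by ring] at key
    push_cast at key ⊢
    rw [show (j : ℤ) + 1 - 1 = j by ring, show (j : ℤ) + 1 - 2 = j - 1 by ring,
      show (j : ℤ) + 1 - 3 = j - 2 by ring, show (j : ℤ) + 1 - 4 = j - 3 by ring]
    apply smul_right_injective V hk
    simp only
    rw [key]
    module

/-! ### The vanishing of `f_k w` for large `k` -/

variable {ρ : Gen → Module.End ℂ V} {n : ℕ} {w : V}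

lemma IsRep.h_one_Y_pow (hρ : IsRep ρ) (hw : IsHighest ρ n w) (N : ℕ) :
    ρ (.h 1) ((ρ (.Y 0) ^ N) w) = 0 := by
  induction N with
  | zero => simpa using hw.h_apply 0
  | succ N ih =>
    rw [pow_succ', Module.End.mul_apply, hρ (.h_Y_odd 0), ih]
    simp

lemma IsRep.f_Y_pow (hρ : IsRep ρ) (r N : ℕ) (v : V) :
    ρ (.f r) ((ρ (.Y 0) ^ N) v) = (ρ (.Y 0) ^ N) (ρ (.f r) v) := by
  induction N with
  | zero => simp
  | succ N ih =>
    rw [pow_succ', Module.End.mul_apply, hρ (.f_Y r), ih]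
    simp

/-- The operator e_r kills w and [e_r, Y_0] = ±f_r commutes with Y_0, so the N + 1 factors
contribute equally. -/
lemma IsRep.e_Y_pow (hρ : IsRep ρ) (hw : IsHighest ρ n w) (r N : ℕ) :
    ρ (.e r) ((ρ (.Y 0) ^ (N + 1)) w) =
      (((N : ℂ) + 1) * (-1) ^ r) • ρ (.f r) ((ρ (.Y 0) ^ N) w) := by
  induction N with
  | zero =>
    simp only [zero_add, pow_one, pow_zero, Module.End.one_apply]
    rw [hρ (.e_Y r), hw.e_apply]
    simp
  | succ N ih =>
    rw [pow_succ', Module.End.mul_apply, hρ (.e_Y r), ih, map_smul]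
    have h : ρ (.Y 0) (ρ (.f r) ((ρ (.Y 0) ^ N) w)) =
        ρ (.f r) ((ρ (.Y 0) ^ (N + 1)) w) := by
      rw [pow_succ' _ N, Module.End.mul_apply, hρ (.f_Y r)]
      simp
    rw [h]
    push_cast
    module

/-- Garland-type identity that turns the relation Y_0^(n+1) w = 0 into f_n w = 0. The two vanishing
statements hold because e_0 f_N w = h_{N+1} w = 0; they remove the leading terms in the inductive
step. -/
lemma IsRep.divPow_e_Y_pow (hρ : IsRep ρ) (hw : IsHighest ρ n w) (N : ℕ) :
    (∃ d : ℂ, d ≠ 0 ∧ divPow (ρ (.e 0)) (2 * N + 1) ((ρ (.Y 0) ^ (N + 1)) w) =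
      d • ρ (.f N) w) ∧
    divPow (ρ (.e 0)) (2 * N + 2) ((ρ (.Y 0) ^ (N + 1)) w) = 0 ∧
    divPow (ρ (.e 0)) (2 * N + 3) ((ρ (.Y 0) ^ (N + 1)) w) = 0 := by
  have tail : ∀ N : ℕ, (∃ d : ℂ, d ≠ 0 ∧
      divPow (ρ (.e 0)) (2 * N + 1) ((ρ (.Y 0) ^ (N + 1)) w) = d • ρ (.f N) w) →
      divPow (ρ (.e 0)) (2 * N + 2) ((ρ (.Y 0) ^ (N + 1)) w) = 0 ∧
      divPow (ρ (.e 0)) (2 * N + 3) ((ρ (.Y 0) ^ (N + 1)) w) = 0 := by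
    rintro N ⟨d, -, hd⟩
    have h1 := apply_divPow (ρ (.e 0)) (2 * N + 1) ((ρ (.Y 0) ^ (N + 1)) w)
    rw [hd, map_smul, hρ (.e_f 0 N), hw.e_apply, hw.h_apply] at h1
    have h2 : divPow (ρ (.e 0)) (2 * N + 2) ((ρ (.Y 0) ^ (N + 1)) w) = 0 := by
      have hne : (((2 * N + 1 : ℤ) : ℂ) + 1) ≠ 0 := by
        norm_cast
      rw [show (2 * N + 1 + 1 : ℤ) = 2 * N + 2 by ring] at h1
      simp only [map_zero, zero_add, smul_zero] at h1
      exact (smul_eq_zero.mp h1.symm).resolve_left hne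
    refine ⟨h2, ?_⟩
    have h3 := apply_divPow (ρ (.e 0)) (2 * N + 2) ((ρ (.Y 0) ^ (N + 1)) w)
    have hne : (((2 * N + 2 : ℤ) : ℂ) + 1) ≠ 0 := by norm_cast
    rw [h2, show (2 * N + 2 + 1 : ℤ) = 2 * N + 3 by ring, map_zero] at h3
    exact (smul_eq_zero.mp h3.symm).resolve_left hne
  suffices h : ∃ d : ℂ, d ≠ 0 ∧ divPow (ρ (.e 0)) (2 * N + 1) ((ρ (.Y 0) ^ (N + 1)) w) =
      d • ρ (.f N) w from ⟨h, tail N h⟩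
  induction N with
  | zero =>
    refine ⟨1, one_ne_zero, ?_⟩
    have h := divPow_natCast (ρ (.e 0)) 1
    simp only [Nat.cast_one, Nat.factorial_one, inv_one, pow_one, one_smul] at h
    have h2 := hρ.e_Y_pow hw 0 0
    simpa [h] using h2
  | succ N ih =>
    obtain ⟨h2, h3⟩ := tail N ih
    obtain ⟨d, hd, h1⟩ := ih
    set v := (ρ (.Y 0) ^ (N + 1)) w with hv
    have c₀ : ∀ u, ρ (.e 0) (ρ (.Y 0) u) = ρ (.Y 0) (ρ (.e 0) u) + ρ (.f 0) u := fun u => by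
      rw [hρ (.e_Y 0)]; simp
    have c₁ : ∀ u, ρ (.e 0) (ρ (.f 0) u) = ρ (.f 0) (ρ (.e 0) u) + ρ (.h 1) u := fun u => by
      rw [hρ (.e_f 0 0)]; simp
    have c₂ : ∀ u, ρ (.e 0) (ρ (.h 1) u) =
        ρ (.h 1) (ρ (.e 0) u) + ((-3 : ℂ) • ρ (.e 1)) u := fun u => by
      rw [hρ .e_h]; simp
    have c₃ : ∀ u, ρ (.e 0) (((-3 : ℂ) • ρ (.e 1)) u) =
        ((-3 : ℂ) • ρ (.e 1)) (ρ (.e 0) u) + ((6 : ℂ) • ρ (.X 1)) u := fun u => by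
      simp only [LinearMap.smul_apply, map_smul]
      rw [hρ .e_e]; module
    have c₄ : ∀ u, ρ (.e 0) (((6 : ℂ) • ρ (.X 1)) u) =
        ((6 : ℂ) • ρ (.X 1)) (ρ (.e 0) u) := fun u => by
      simp only [LinearMap.smul_apply, map_smul]
      rw [hρ .e_X]; module
    -- Expand divided powers of e_0 on Y_0 v, f_0 v and h_1 v. All three involve only f_{N+1} w and
    -- the unknown vectors e_1 e_0^(2N) v and X_1 e_0^(2N-1) v; the third expansion is zero because
    -- h_1 v = 0.
    have A := divPow_apply_chain _ _ _ _ _ _ c₀ c₁ c₂ c₃ c₄ (2 * N + 3) v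
    have B := divPow_apply_chain _ _ _ _ _ 0 c₁ c₂ c₃ (by simpa using c₄) (by simp)
      (2 * N + 2) v
    have C := divPow_apply_chain _ _ _ _ 0 0 c₂ c₃ (by simpa using c₄) (by simp) (by simp)
      (2 * N + 1) v
    have eY := hρ.e_Y_pow hw 0 (N + 1)
    rw [← hv] at eY
    -- Together with e_0 Y_0 v = (N + 2) f_0 v this gives the second relation between the
    -- expansions: (N + 2) B = (2N + 3) A on left-hand sides.
    have eD : divPow (ρ (.e 0)) (2 * N + 2) (ρ (.e 0) (ρ (.Y 0) v)) =
        ((2 * N + 3 : ℂ)) • divPow (ρ (.e 0)) (2 * N + 3) (ρ (.Y 0) v) := by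
      have := apply_divPow (ρ (.e 0)) (2 * N + 2) (ρ (.Y 0) v)
      rw [show (2 * N + 2 + 1 : ℤ) = 2 * N + 3 by ring] at this
      have hc : ρ (.e 0) (divPow (ρ (.e 0)) (2 * N + 2) (ρ (.Y 0) v)) =
          divPow (ρ (.e 0)) (2 * N + 2) (ρ (.e 0) (ρ (.Y 0) v)) := by
        rw [show (2 * N + 2 : ℤ) = ((2 * N + 2 : ℕ) : ℤ) by push_cast; ring, divPow_natCast]
        simp only [LinearMap.smul_apply, map_smul, ← Module.End.mul_apply, ← mul_assoc]
        rw [← pow_succ, ← pow_succ']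
      rw [← hc, this]
      push_cast
      congr 1
      ring
    have vY : (ρ (.Y 0) ^ (N + 1 + 1)) w = ρ (.Y 0) v := by
      rw [pow_succ', Module.End.mul_apply]
    rw [vY] at eY
    rw [eY, map_smul] at eD
    have hz := hρ.h_one_Y_pow hw (N + 1)
    rw [← hv] at hz
    have hf := hρ (.h_f 1 N) w
    rw [hw.h_apply 0, map_zero, zero_add] at hf
    push_cast at A B C
    rw [show (2 * N + 3 - 1 : ℤ) = 2 * N + 2 by ring, show (2 * N + 3 - 2 : ℤ) = 2 * N + 1 by ring,
      show (2 * N + 3 - 3 : ℤ) = 2 * N by ring, show (2 * N + 3 - 4 : ℤ) = 2 * N - 1 by ring,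
      h3, h2, h1] at A
    rw [show (2 * N + 2 - 1 : ℤ) = 2 * N + 1 by ring, show (2 * N + 2 - 2 : ℤ) = 2 * N by ring,
      show (2 * N + 2 - 3 : ℤ) = 2 * N - 1 by ring, h2, h1] at B
    rw [show (2 * N + 1 - 1 : ℤ) = 2 * N by ring, show (2 * N + 1 - 2 : ℤ) = 2 * N - 1 by ring,
      hz, h1] at C
    simp only [map_zero, map_smul, hf, LinearMap.smul_apply, LinearMap.zero_apply, smul_zero,
      add_zero, zero_add] at A B C
    -- Eliminating the unknown vectors by C gives B = 2A + (d/2) f_{N+1} w; inserting this in (N +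
    -- 2) B = (2N + 3) A yields the constant.
    refine ⟨-((N + 2) * d / 2), ?_, ?_⟩
    · have : (N : ℂ) + 2 ≠ 0 := by exact_mod_cast (by lia : N + 2 ≠ 0)
      simp [this, hd]
    · rw [vY, show (2 * (N + 1 : ℕ) + 1 : ℤ) = 2 * N + 3 by push_cast; ring, add_comm N 1]
      push_cast at eD
      linear_combination (norm := module) (2 * (N + 2 : ℂ)) • A - (N + 2 : ℂ) • B + eD +
        ((N + 2 : ℂ) / 6) • C

/-- The case k = n is the Garland-type identity; larger k follow from h_1 f_k w = -3 f_{k+1} w. -/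
lemma IsRep.f_apply_eq_zero (hρ : IsRep ρ) (hw : IsHighest ρ n w) {k : ℕ} (hk : n ≤ k) :
    ρ (.f k) w = 0 := by
  induction k, hk using Nat.le_induction with
  | base =>
    obtain ⟨⟨d, hd, h⟩, -, -⟩ := hρ.divPow_e_Y_pow hw n
    rw [hw.Y_pow, map_zero] at h
    exact (smul_eq_zero.mp h.symm).resolve_left hd
  | succ k hk ih =>
    have h := hρ (.h_f 1 k) w
    rw [ih, hw.h_apply 0, map_zero, map_zero, zero_add, add_comm 1 k] at h
    refine (smul_eq_zero.mp h.symm).resolve_left ?_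
    norm_num

end Rep
end TwistedA22

namespace TwistedA22

section Rep

variable {V : Type} [AddCommGroup V] [Module ℂ V]
variable {ρ : Gen → Module.End ℂ V} {n : ℕ} {w : V}

/-! ### Quotients and degree shifts of representations -/

/-- The representation on the quotient by a stable subspace. -/
noncomputable def quotRep (ρ : Gen → Module.End ℂ V) (N : Submodule ℂ V)
    (hN : ∀ x, N ≤ N.comap (ρ x)) (x : Gen) : Module.End ℂ (V ⧸ N) :=
  N.mapQ N (ρ x) (hN x)

lemma quotRep_mkQ (N : Submodule ℂ V) (hN : ∀ x, N ≤ N.comap (ρ x)) (x : Gen) (v : V) :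
    quotRep ρ N hN x (N.mkQ v) = N.mkQ (ρ x v) := rfl

lemma IsRep.isRep_quotRep (hρ : IsRep ρ) (N : Submodule ℂ V) (hN : ∀ x, N ≤ N.comap (ρ x)) :
    IsRep (quotRep ρ N hN) := by
  intro x y c z b v
  obtain ⟨v, rfl⟩ := N.mkQ_surjective v
  simp only [quotRep_mkQ, hρ b, map_add, map_smul]

lemma quotRep_pow_mkQ (N : Submodule ℂ V) (hN : ∀ x, N ≤ N.comap (ρ x)) (x : Gen) (k : ℕ)
    (v : V) : (quotRep ρ N hN x ^ k) (N.mkQ v) = N.mkQ ((ρ x ^ k) v) := by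
  induction k with
  | zero => rfl
  | succ k ih => rw [pow_succ', pow_succ', Module.End.mul_apply, ih, quotRep_mkQ]; rfl

lemma act_quotRep_mkQ (N : Submodule ℂ V) (hN : ∀ x, N ≤ N.comap (ρ x)) (L : List Gen)
    (v : V) : act (quotRep ρ N hN) L (N.mkQ v) = N.mkQ (act ρ L v) := by
  induction L with
  | nil => simp
  | cons x L ih => rw [act_cons, act_cons, ih, quotRep_mkQ]

lemma IsHighest.mkQ (hw : IsHighest ρ n w) (N : Submodule ℂ V) (hN : ∀ x, N ≤ N.comap (ρ x)) :
    IsHighest (quotRep ρ N hN) n (N.mkQ w) where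
  X_apply r := by rw [quotRep_mkQ, hw.X_apply, map_zero]
  e_apply r := by rw [quotRep_mkQ, hw.e_apply, map_zero]
  h_apply r := by rw [quotRep_mkQ, hw.h_apply, map_zero]
  h_zero := by rw [quotRep_mkQ, hw.h_zero, map_smul]
  Y_pow := by rw [quotRep_pow_mkQ, hw.Y_pow, map_zero]

/-- Modulo the vectors `f_i w` with `i > j`, the vector `f_j w` satisfies the relations of the
local Weyl module of the next smaller highest weight. -/
lemma IsRep.isHighest_mkQ_f (hρ : IsRep ρ) (hw : IsHighest ρ (n + 1) w) (j : ℕ)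
    (N : Submodule ℂ V) (hN : ∀ x, N ≤ N.comap (ρ x)) (hf : ∀ i, j < i → ρ (.f i) w ∈ N) :
    IsHighest (quotRep ρ N hN) n (N.mkQ (ρ (.f j) w)) where
  X_apply r := by
    rw [quotRep_mkQ, hρ (.X_f r j), hw.X_apply, hw.e_apply]; simp
  e_apply r := by
    rw [quotRep_mkQ, hρ (.e_f r j), hw.e_apply, hw.h_apply]; simp
  h_apply r := by
    rw [quotRep_mkQ, hρ (.h_f (r + 1) j), hw.h_apply, map_zero, zero_add, map_smul]
    have : N.mkQ (ρ (.f (r + 1 + j)) w) = 0 := by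
      simpa using hf (r + 1 + j) (by lia)
    rw [this, smul_zero]
  h_zero := by
    have h := hρ (.h_f 0 j) w
    rw [hw.h_zero, zero_add, pow_zero, map_smul] at h
    rw [quotRep_mkQ, h]
    refine (congrArg N.mkQ ?_).trans (map_smul N.mkQ (n : ℂ) _)
    push_cast
    module
  Y_pow := by
    rw [quotRep_pow_mkQ, ← hρ.f_Y_pow]
    -- Applying e_j to Y_0^(n+2) w = 0 gives a nonzero multiple of f_j Y_0^(n+1) w.
    have h := hρ.e_Y_pow hw j (n + 1)
    rw [hw.Y_pow, map_zero] at h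
    have hne : (((n + 1 : ℕ) : ℂ) + 1) * (-1) ^ j ≠ 0 := by
      refine mul_ne_zero ?_ (pow_ne_zero _ (by norm_num))
      exact_mod_cast (n + 1).succ_ne_zero
    rw [(smul_eq_zero.mp h.symm).resolve_left hne, map_zero]

/-- The graded representation on families of vectors indexed by degrees. -/
def shiftRep (ρ : Gen → Module.End ℂ V) (x : Gen) : Module.End ℂ (ℤ × ℤ → V) where
  toFun φ μ := ρ x (φ (μ - x.deg))
  map_add' φ ψ := by ext; simp
  map_smul' c φ := by ext; simp

lemma shiftRep_apply (x : Gen) (φ : ℤ × ℤ → V) (μ : ℤ × ℤ) :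
    shiftRep ρ x φ μ = ρ x (φ (μ - x.deg)) := rfl

lemma IsRep.isRep_shiftRep (hρ : IsRep ρ) : IsRep (shiftRep ρ) := by
  intro x y c z b φ
  ext μ
  simp only [Pi.add_apply, Pi.smul_apply, shiftRep_apply]
  rw [hρ b, sub_right_comm]
  rcases b.deg_eq with rfl | h
  · simp
  · rw [h, show μ - (x.deg + y.deg) = μ - y.deg - x.deg by abel]

lemma shiftRep_single (x : Gen) (μ : ℤ × ℤ) (v : V) :
    shiftRep ρ x (Pi.single μ v) = Pi.single (x.deg + μ) (ρ x v) := by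
  ext ν
  rw [shiftRep_apply, Pi.single_apply, Pi.single_apply]
  by_cases h : ν = x.deg + μ
  · rw [if_pos h, if_pos (by rw [h]; abel)]
  · rw [if_neg h, if_neg (fun h' => h (by rw [← h']; abel)), map_zero]

lemma act_shiftRep_single (L : List Gen) (μ : ℤ × ℤ) (v : V) :
    act (shiftRep ρ) L (Pi.single μ v) = Pi.single (wordDeg L + μ) (act ρ L v) := by
  induction L with
  | nil => simp
  | cons x L ih => rw [act_cons, act_cons, ih, shiftRep_single, wordDeg_cons, add_assoc]

lemma shiftRep_pow_single (x : Gen) (k : ℕ) (μ : ℤ × ℤ) (v : V) :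
    (shiftRep ρ x ^ k) (Pi.single μ v) = Pi.single (k • x.deg + μ) ((ρ x ^ k) v) := by
  rw [← act_replicate, ← act_replicate, act_shiftRep_single, wordDeg_replicate]

lemma IsHighest.single (hw : IsHighest ρ n w) :
    IsHighest (shiftRep ρ) n (Pi.single 0 w) where
  X_apply r := by rw [shiftRep_single, hw.X_apply, Pi.single_zero]
  e_apply r := by rw [shiftRep_single, hw.e_apply, Pi.single_zero]
  h_apply r := by rw [shiftRep_single, hw.h_apply, Pi.single_zero]
  h_zero := by
    rw [shiftRep_single, hw.h_zero, ← Pi.single_smul]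
    simp [Gen.deg, ← Prod.zero_eq_mk]
  Y_pow := by rw [shiftRep_pow_single, hw.Y_pow, Pi.single_zero]

/-- The submodule generated by the vectors `f_i w` with `i ∈ S`. -/
def fSubmodule (ρ : Gen → Module.End ℂ V) (w : V) (S : Set ℕ) : Submodule ℂ V :=
  Submodule.span ℂ {v | ∃ (L : List Gen) (i : ℕ), i ∈ S ∧ v = act ρ L (ρ (.f i) w)}

lemma fSubmodule_le_comap (w : V) (S : Set ℕ) (x : Gen) :
    fSubmodule ρ w S ≤ (fSubmodule ρ w S).comap (ρ x) := by
  refine Submodule.span_le.mpr ?_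
  rintro v ⟨L, i, hi, rfl⟩
  exact Submodule.subset_span ⟨x :: L, i, hi, (act_cons _ _ _ _).symm⟩

lemma f_mem_fSubmodule (w : V) {S : Set ℕ} {i : ℕ} (hi : i ∈ S) :
    ρ (.f i) w ∈ fSubmodule ρ w S :=
  Submodule.subset_span ⟨[], i, hi, (act_nil _ _).symm⟩

/-- The spanning vectors are concentrated in single degrees, so the component at μ only sees words
of total degree μ. This is what the passage to `shiftRep` gains. -/
lemma apply_eq_zero_of_mem_fSubmodule {S : Set ℕ} {μ : ℤ × ℤ}
    (H : ∀ (L : List Gen) (i : ℕ), i ∈ S → wordDeg L + (Gen.f i).deg = μ →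
      act ρ L (ρ (.f i) w) = 0) {φ : ℤ × ℤ → V}
    (hφ : φ ∈ fSubmodule (shiftRep ρ) (Pi.single 0 w) S) : φ μ = 0 := by
  have hle : fSubmodule (shiftRep ρ) (Pi.single 0 w) S ≤
      LinearMap.ker (LinearMap.proj (R := ℂ) (φ := fun _ : ℤ × ℤ => V) μ) := by
    refine Submodule.span_le.mpr ?_
    rintro v ⟨L, i, hi, rfl⟩
    rw [shiftRep_single, act_shiftRep_single, add_zero]
    simp only [SetLike.mem_coe, LinearMap.mem_ker, LinearMap.proj_apply, Pi.single_apply]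
    split_ifs with h
    · exact H L i hi h.symm
    · rfl
  exact hle hφ

/-! ### The weight estimate -/

/-- If all `f_k` kill the generator, then the module is spanned by the vectors `Y_0^j w`. -/
lemma IsRep.act_mem_span_Y_pow (hρ : IsRep ρ) (hw : IsHighest ρ n w)
    (hf : ∀ k, ρ (.f k) w = 0) (L : List Gen) :
    act ρ L w ∈ Submodule.span ℂ (Set.range fun j : ℕ => (ρ (.Y 0) ^ j) w) := by
  set T := Submodule.span ℂ (Set.range fun j : ℕ => (ρ (.Y 0) ^ j) w) with hT
  have mem : ∀ j : ℕ, (ρ (.Y 0) ^ j) w ∈ T := fun j => Submodule.subset_span ⟨j, rfl⟩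
  have stable : ∀ {x : Gen}, (∀ j : ℕ, ρ x ((ρ (.Y 0) ^ j) w) ∈ T) → ∀ v ∈ T, ρ x v ∈ T := by
    intro x hx v hv
    have : T ≤ T.comap (ρ x) := by
      refine Submodule.span_le.mpr ?_
      rintro _ ⟨j, rfl⟩
      exact hx j
    exact this hv
  have hY0 : ∀ v ∈ T, ρ (.Y 0) v ∈ T := stable fun j => by
    rw [← Module.End.mul_apply, ← pow_succ']
    exact mem (j + 1)
  -- Stability under x follows from stability under [x, Y_0]; hence the order Y, f, h, then X and e.
  have step : ∀ {x z : Gen} {c : ℂ}, Bracket x (.Y 0) c z → ρ x w ∈ T →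
      (c = 0 ∨ ∀ v ∈ T, ρ z v ∈ T) → ∀ v ∈ T, ρ x v ∈ T := by
    intro x z c b h0 hz
    refine stable fun j => ?_
    induction j with
    | zero => simpa using h0
    | succ j ih =>
      rw [pow_succ', Module.End.mul_apply, hρ b]
      refine T.add_mem (hY0 _ ih) ?_
      rcases hz with rfl | hz
      · simp
      · exact T.smul_mem _ (hz _ (mem j))
  have hY : ∀ r, ∀ v ∈ T, ρ (.Y r) v ∈ T := by
    rintro (_ | r)
    · exact hY0
    · refine step (.Y_Y (r + 1)) ?_ (Or.inl rfl)
      -- Y_{r+1} is a multiple of [f_0, f_{2r+1}], and both factors kill w.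
      have h := hρ (.f_f r) w
      rw [hf, hf, map_zero, map_zero, zero_add] at h
      rw [(smul_eq_zero.mp h.symm).resolve_left (by norm_num)]
      exact T.zero_mem
  have hF : ∀ r, ∀ v ∈ T, ρ (.f r) v ∈ T := fun r =>
    step (.f_Y r) (by rw [hf]; exact T.zero_mem) (Or.inl rfl)
  have hw_mem : w ∈ T := by simpa using mem 0
  have hH0 : ∀ r, ρ (.h r) w ∈ T := by
    rintro (_ | r)
    · rw [hw.h_zero]; exact T.smul_mem _ hw_mem
    · rw [hw.h_apply]; exact T.zero_mem
  have hH : ∀ r, ∀ v ∈ T, ρ (.h r) v ∈ T := by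
    intro r
    rcases Nat.even_or_odd' r with ⟨s, rfl | rfl⟩
    · exact step (.h_Y_even s) (hH0 _) (Or.inr (hY s))
    · exact step (.h_Y_odd s) (hH0 _) (Or.inl rfl)
  have all : ∀ x : Gen, ∀ v ∈ T, ρ x v ∈ T := by
    rintro (r | r | r | r | r)
    · exact step (.X_Y r) (by rw [hw.X_apply]; exact T.zero_mem) (Or.inr (hH _))
    · exact hY r
    · exact step (.e_Y r) (by rw [hw.e_apply]; exact T.zero_mem) (Or.inr (hF r))
    · exact hF r
    · exact hH r
  induction L with
  | nil => simpa using hw_mem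
  | cons x L ih => rw [act_cons]; exact all x _ ih

/-- Modulo the f_i w only the vectors Y_0^j w remain, so the estimate needs checking only on the
submodule generated by the f_i w. -/
lemma IsRep.act_eq_zero_of_act_f (hρ : IsRep ρ) (hw : IsHighest ρ n w)
    (H : ∀ (L : List Gen) (i : ℕ),
      (n : ℤ) ^ 2 - (n + (wordDeg L + (Gen.f i).deg).1) ^ 2 <
        (wordDeg L + (Gen.f i).deg).2 → act ρ L (ρ (.f i) w) = 0)
    (L : List Gen) (hL : (n : ℤ) ^ 2 - (n + (wordDeg L).1) ^ 2 < (wordDeg L).2) :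
    act ρ L w = 0 := by
  set M := fSubmodule (shiftRep ρ) (Pi.single 0 w) Set.univ with hM
  have hMs := fSubmodule_le_comap (ρ := shiftRep ρ) (Pi.single 0 w) Set.univ
  have h := (hρ.isRep_shiftRep.isRep_quotRep M hMs).act_mem_span_Y_pow (hw.single.mkQ M hMs)
    (fun k => by
      rw [quotRep_mkQ, Submodule.mkQ_apply, Submodule.Quotient.mk_eq_zero]
      exact f_mem_fSubmodule _ (Set.mem_univ k)) L
  have hr : (Set.range fun j : ℕ => (quotRep (shiftRep ρ) M hMs (.Y 0) ^ j)
      (M.mkQ (Pi.single 0 w))) =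
      M.mkQ '' Set.range fun j : ℕ => (shiftRep ρ (.Y 0) ^ j) (Pi.single 0 w) := by
    rw [← Set.range_comp]
    congr 1
    ext j
    exact quotRep_pow_mkQ M hMs _ _ _
  rw [act_quotRep_mkQ, hr, ← Submodule.map_span] at h
  obtain ⟨t, ht, hts⟩ := h
  have hdiff : act (shiftRep ρ) L (Pi.single 0 w) - t ∈ M := by
    rw [← Submodule.Quotient.mk_eq_zero, ← Submodule.mkQ_apply, map_sub, hts, sub_self]
  have h0 := apply_eq_zero_of_mem_fSubmodule (μ := wordDeg L)
    (fun L' i _ hd => H L' i (by rw [hd]; exact hL)) hdiff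
  have hle : Submodule.span ℂ (Set.range fun j : ℕ =>
      (shiftRep ρ (.Y 0) ^ j) (Pi.single 0 w)) ≤
      LinearMap.ker (LinearMap.proj (R := ℂ) (φ := fun _ : ℤ × ℤ => V) (wordDeg L)) := by
    refine Submodule.span_le.mpr ?_
    rintro _ ⟨j, rfl⟩
    simp only [SetLike.mem_coe, LinearMap.mem_ker, LinearMap.proj_apply, shiftRep_pow_single,
      Pi.single_apply]
    split_ifs with hd
    · rw [hd] at hL
      simp only [Gen.deg, add_zero, Prod.smul_mk] at hL
      simp only [nsmul_eq_mul, Nat.cast_zero, mul_zero] at hL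
      -- For j ≤ n one has n² - (n - 2j)² = 4j(n - j) ≥ 0, while Y_0^j has δ-degree 0.
      have hj : n + 1 ≤ j := by
        by_contra hlt
        have h1 : (0 : ℤ) ≤ j := by positivity
        have h2 : (j : ℤ) ≤ n := by exact_mod_cast (by lia : j ≤ n)
        nlinarith
      obtain ⟨k, rfl⟩ := Nat.exists_eq_add_of_le' hj
      rw [pow_add, Module.End.mul_apply, hw.Y_pow, map_zero]
    · rfl
  have ht0 : t (wordDeg L) = 0 := hle ht
  rw [Pi.sub_apply, ht0, sub_zero, act_shiftRep_single, add_zero, Pi.single_eq_same] at h0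
  exact h0

/-- The weights `nΛ + m (α/2) + d (δ/2)` of a module with the relations of the local Weyl module
satisfy `d ≤ n² - (n + m)²`. -/
theorem IsRep.act_eq_zero (hρ : IsRep ρ) (hw : IsHighest ρ n w) (L : List Gen)
    (hL : (n : ℤ) ^ 2 - (n + (wordDeg L).1) ^ 2 < (wordDeg L).2) : act ρ L w = 0 := by
  induction n generalizing V L with
  | zero =>
    refine hρ.act_eq_zero_of_act_f hw (fun L i _ => ?_) L hL
    rw [hρ.f_apply_eq_zero hw i.zero_le, map_zero]
  | succ n ih =>
    refine hρ.act_eq_zero_of_act_f hw ?_ L hL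
    -- Descending induction on i, with d bounding the distance to n + 1, from where on f_i w = 0.
    suffices h : ∀ (d i : ℕ), n + 1 ≤ i + d → ∀ L : List Gen,
        ((n + 1 : ℕ) : ℤ) ^ 2 - ((n + 1 : ℕ) + (wordDeg L + (Gen.f i).deg).1) ^ 2 <
          (wordDeg L + (Gen.f i).deg).2 → act ρ L (ρ (.f i) w) = 0 from
      fun L i => h (n + 1) i (by lia) L
    intro d
    induction d with
    | zero =>
      intro i hi L _
      rw [hρ.f_apply_eq_zero hw (k := i) hi, map_zero]
    | succ d ihd =>
      intro j hj L hL
      by_cases hjn : n + 1 ≤ j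
      · rw [hρ.f_apply_eq_zero hw hjn, map_zero]
      set M := fSubmodule (shiftRep ρ) (Pi.single 0 w) (Set.Ioi j) with hM
      have hMs := fSubmodule_le_comap (ρ := shiftRep ρ) (Pi.single 0 w) (Set.Ioi j)
      have h := ih (hρ.isRep_shiftRep.isRep_quotRep M hMs)
        (hρ.isRep_shiftRep.isHighest_mkQ_f hw.single j M hMs fun i hi => f_mem_fSubmodule _ hi) L
        (by
          -- The bound passes from n + 1 to n because f_j adds 2j + 1 ≤ 2n + 1 = (n + 1)² - n² to
          -- the degree and lowers n + 1 to n.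
          have hj' : (j : ℤ) ≤ n := by exact_mod_cast (by lia : j ≤ n)
          simp only [Gen.deg, Prod.fst_add, Prod.snd_add] at hL
          push_cast at hL
          linarith)
      rw [act_quotRep_mkQ, Submodule.mkQ_apply, Submodule.Quotient.mk_eq_zero,
        shiftRep_single, act_shiftRep_single, add_zero] at h
      have h0 := apply_eq_zero_of_mem_fSubmodule (μ := wordDeg L + (Gen.f j).deg)
        (fun L' i hi hd => ihd i (by have : j < i := hi; lia) L' (by rw [hd]; exact hL)) h
      rwa [Pi.single_eq_same] at h0

end Rep
end TwistedA22

namespace TwistedA22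

/-! ### The action on the local Weyl module -/

/-- The basis vector of the current algebra with the given label. -/
noncomputable def Gen.elt : Gen → currentAlgebra
  | .X r => rootVector (.posLong r)
  | .Y r => rootVector (.negLong r)
  | .e r => rootVector (.posHalf r)
  | .f r => rootVector (.negHalf r)
  | .h r => imagVector r

/-- The `sl₃`-component of a basis vector. -/
noncomputable def Gen.matrixPart : Gen → SL3
  | .X _ => Xp12
  | .Y _ => Xm12
  | .e r => Xp1 + (-1 : ℂ) ^ r • Xp2
  | .f r => Xm1 - (-1 : ℂ) ^ r • Xm2
  | .h r => H1 + (-1 : ℂ) ^ r • H2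

/-- The `t`-exponent of a basis vector. -/
def Gen.exponent : Gen → ℤ
  | .X r => 2 * r + 1
  | .Y r => 2 * r - 1
  | .e r => r + 1
  | .f r => r
  | .h r => r

lemma Gen.coe_elt (x : Gen) : (x.elt : LoopSL3) = loop x.exponent x.matrixPart := by
  cases x with
  | X r => rfl
  | Y r => rfl
  | e r =>
    refine (rootVectorLoop_posHalf r).trans ?_
    simp [exponent, matrixPart, pow_succ]
  | f r => exact rootVectorLoop_negHalf r
  | h r => exact imagVectorLoop_eq r

lemma Bracket.exponent_eq {x y z : Gen} {c : ℂ} (b : Bracket x y c z) :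
    c = 0 ∨ x.exponent + y.exponent = z.exponent := by
  cases b <;> first | exact Or.inl rfl | (refine Or.inr ?_; simp [Gen.exponent]; try ring)

/-! ### Verification of the commutators in `sl₃` and in the loop algebra -/

lemma lie_H_Xm12 (a : ℂ) : ⁅H1 + a • H2, Xm12⁆ = (-(1 + a)) • Xm12 := by
  apply sl3_lie
  intro i j
  fin_cases i <;> fin_cases j <;>
    simp [Xm12, H1, H2, E, Matrix.mul_apply, Matrix.single_apply]
  ring

lemma lie_Xp_Xm12 (a : ℂ) : ⁅Xp1 + a • Xp2, Xm12⁆ = a • Xm1 - Xm2 := by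
  apply sl3_lie
  intro i j
  fin_cases i <;> fin_cases j <;>
    simp [Xm12, Xp1, Xp2, Xm1, Xm2, E, Matrix.mul_apply, Matrix.single_apply]

lemma lie_Xm_Xm12 (a : ℂ) : ⁅Xm1 - a • Xm2, Xm12⁆ = 0 := by
  apply sl3_lie
  intro i j
  fin_cases i <;> fin_cases j <;>
    simp [Xm12, Xm1, Xm2, E, Matrix.mul_apply, Matrix.single_apply]

lemma lie_Xp_Xp12 (a : ℂ) : ⁅Xp1 + a • Xp2, Xp12⁆ = 0 := by
  apply sl3_lie
  intro i j
  fin_cases i <;> fin_cases j <;>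
    simp [Xp12, Xp1, Xp2, E, Matrix.mul_apply, Matrix.single_apply]

lemma lie_H_Xm_general (a b : ℂ) :
    ⁅H1 + a • H2, Xm1 - b • Xm2⁆ = (a - 2) • Xm1 - (b * (1 - 2 * a)) • Xm2 := by
  apply sl3_lie
  intro i j
  fin_cases i <;> fin_cases j <;>
    simp [Xm1, Xm2, H1, H2, E, Matrix.mul_apply, Matrix.single_apply] <;> ring

lemma neg_one_pow_mul_self (r : ℕ) : (-1 : ℂ) ^ r * (-1) ^ r = 1 := by
  rw [← mul_pow]; simp

lemma Bracket.lie_matrixPart {x y z : Gen} {c : ℂ} (b : Bracket x y c z) :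
    ⁅x.matrixPart, y.matrixPart⁆ = c • z.matrixPart := by
  cases b with
  | X_Y r => simp [Gen.matrixPart, lie_Xp12_Xm12, pow_mul]
  | h_Y_even r =>
    simp only [Gen.matrixPart, lie_H_Xm12, pow_mul]
    norm_num
  | h_Y_odd r =>
    simp only [Gen.matrixPart, lie_H_Xm12, pow_succ, pow_mul]
    norm_num
  | Y_Y r => simp [Gen.matrixPart]
  | e_Y r =>
    simp only [Gen.matrixPart, lie_Xp_Xm12, smul_sub, smul_smul, neg_one_pow_mul_self, one_smul]
  | f_Y r => simp only [Gen.matrixPart, lie_Xm_Xm12, zero_smul]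
  | f_f r =>
    simp only [Gen.matrixPart, sub_eq_add_neg, ← neg_smul, lie_Xm_Xm, pow_succ, pow_mul]
    norm_num
  | e_f r s =>
    simp only [Gen.matrixPart, lie_Xp_Xm, one_smul, pow_add, pow_one]
    module
  | X_f r s =>
    simp only [Gen.matrixPart, lie_Xp12_Xm, pow_add, pow_mul, smul_add, smul_smul]
    rw [neg_one_sq, one_pow, one_mul, neg_mul, neg_mul, neg_one_pow_mul_self]
    module
  | h_f r s =>
    have h := neg_one_pow_mul_self r
    simp only [Gen.matrixPart, smul_sub, smul_smul]
    rw [lie_H_Xm_general]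
    congr 2
    rw [pow_add]
    linear_combination (-(-1 : ℂ) ^ s) * h
  | e_h =>
    have h := lie_H_Xp 1
    rw [← lie_skew]
    simp only [Gen.matrixPart, pow_zero, pow_one, neg_smul, one_smul, ← sub_eq_add_neg] at h ⊢
    rw [h]
  | e_e =>
    simp only [Gen.matrixPart, lie_Xp_Xp]
    norm_num
  | e_X => simp only [Gen.matrixPart, lie_Xp_Xp12, zero_smul]

lemma Bracket.lie_elt {x y z : Gen} {c : ℂ} (b : Bracket x y c z) :
    ⁅x.elt, y.elt⁆ = c • z.elt := by
  apply Subtype.ext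
  change ⁅(x.elt : LoopSL3), (y.elt : LoopSL3)⁆ = c • (z.elt : LoopSL3)
  rw [Gen.coe_elt, Gen.coe_elt, Gen.coe_elt, loop_lie, b.lie_matrixPart, loop_smul]
  rcases b.exponent_eq with rfl | h
  · simp
  · rw [h]

/-! ### The local Weyl module as an instance of the abstract setting -/

/-- The action of the basis vectors on the local Weyl module. -/
noncomputable def weylRep (n : ℕ) (x : Gen) : Module.End ℂ (LocalWeyl n) :=
  Module.toModuleEnd ℂ (S := U) (LocalWeyl n) (toU x.elt)

lemma weylRep_apply (n : ℕ) (x : Gen) (v : LocalWeyl n) :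
    weylRep n x v = toU x.elt • v := rfl

lemma weylRep_pow_apply (n : ℕ) (x : Gen) (k : ℕ) (v : LocalWeyl n) :
    (weylRep n x ^ k) v = toU x.elt ^ k • v := by
  rw [weylRep, ← map_pow]; rfl

lemma isRep_weylRep (n : ℕ) : IsRep (weylRep n) := by
  intro x y c z b v
  have h : toU x.elt * toU y.elt - toU y.elt * toU x.elt = c • toU z.elt := by
    let : LieRing U := LieRing.ofAssociativeRing
    let : LieAlgebra ℂ U := LieAlgebra.ofAssociativeAlgebra
    have hl := LieHom.map_lie (UniversalEnvelopingAlgebra.ι ℂ) x.elt y.elt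
    rw [b.lie_elt] at hl
    exact hl.symm.trans ((UniversalEnvelopingAlgebra.ι ℂ).toLinearMap.map_smul c z.elt)
  simp only [weylRep_apply]
  rw [smul_smul, smul_smul, ← smul_assoc, ← h, ← add_smul, add_sub_cancel]

lemma smul_weylVector_eq_zero {n : ℕ} {u : U} (hu : u ∈ weylRelations n) :
    u • weylVector n = 0 := by
  rw [weylVector, ← Submodule.Quotient.mk_smul, smul_eq_mul, mul_one]
  exact (Submodule.Quotient.mk_eq_zero _).mpr hu

lemma toU_smul_weylVector {n : ℕ} {x : currentAlgebra} (hx : x ∈ posPart ⊔ imagPart) :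
    toU x • weylVector n = 0 :=
  smul_weylVector_eq_zero (Submodule.subset_span (Or.inl ⟨x, hx, rfl⟩))

lemma isHighest_weylVector (n : ℕ) : IsHighest (weylRep n) n (weylVector n) where
  X_apply r := toU_smul_weylVector (Submodule.mem_sup_left
    (Submodule.subset_span ⟨.posLong r, Or.inl ⟨r, rfl⟩, rfl⟩))
  e_apply r := toU_smul_weylVector (Submodule.mem_sup_left
    (Submodule.subset_span ⟨.posHalf r, Or.inr ⟨r, rfl⟩, rfl⟩))
  h_apply r := toU_smul_weylVector (Submodule.mem_sup_right
    (Submodule.subset_span ⟨r + 1, by lia, rfl⟩))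
  h_zero := by
    have h : (toU (imagVector 0) - (n : U)) • weylVector n = 0 :=
      smul_weylVector_eq_zero (Submodule.subset_span (Or.inr (Or.inl rfl)))
    rw [sub_smul, sub_eq_zero] at h
    rw [weylRep_apply]
    refine h.trans ?_
    rw [Nat.cast_smul_eq_nsmul, Nat.cast_smul_eq_nsmul]
  Y_pow := by
    rw [weylRep_pow_apply]
    exact smul_weylVector_eq_zero (Submodule.subset_span (Or.inr (Or.inr rfl)))

/-! ### Vanishing powers of root vectors -/

lemma toU_pow_smul_weylVector (n : ℕ) (x : Gen) (k : ℕ)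
    (h : (n : ℤ) ^ 2 - (n + k * x.deg.1) ^ 2 < k * x.deg.2) :
    toU x.elt ^ k • weylVector n = 0 := by
  rw [← weylRep_pow_apply, ← act_replicate]
  refine (isRep_weylRep n).act_eq_zero (isHighest_weylVector n) _ ?_
  rw [wordDeg_replicate]
  simpa using h

/-- For p = 2n - 2k the degree p(2k + 1) exceeds the bound n² - (n - p)² = 2kp by p > 0. -/
lemma negHalf_pow_smul_weylVector {n k : ℕ} (hk : k < n) :
    toU (rootVector (.negHalf k)) ^ (2 * n - 2 * k) • weylVector n = 0 := by
  refine toU_pow_smul_weylVector n (.f k) _ ?_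
  obtain ⟨m, rfl⟩ := Nat.exists_eq_add_of_lt hk
  rw [show 2 * (k + m + 1) - 2 * k = 2 * m + 2 by lia]
  simp only [Gen.deg]
  push_cast
  nlinarith

lemma negHalf_smul_weylVector {n k : ℕ} (hk : n ≤ k) :
    toU (rootVector (.negHalf k)) • weylVector n = 0 := by
  rw [← pow_one (toU (rootVector (.negHalf k)))]
  refine toU_pow_smul_weylVector n (.f k) 1 ?_
  simp only [Gen.deg]
  push_cast
  have : (n : ℤ) ≤ k := by exact_mod_cast hk
  nlinarith

/-- For r ≤ n and p = n - r + 1 the degree 4rp exceeds the bound 4p(n - p) = 4p(r - 1). For r ≥ n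
the truncated exponent is 1, and 4r > 4(n - 1). -/
lemma negLong_pow_smul_weylVector {n r : ℕ} (hr : 1 ≤ r) :
    toU (rootVector (.negLong r)) ^ (n - r + 1) • weylVector n = 0 := by
  refine toU_pow_smul_weylVector n (.Y r) _ ?_
  simp only [Gen.deg]
  have h1 : (1 : ℤ) ≤ r := by exact_mod_cast hr
  rcases le_total r n with h | h
  · obtain ⟨m, rfl⟩ := Nat.exists_eq_add_of_le h
    rw [show r + m - r = m by lia]
    push_cast
    nlinarith
  · rw [show n - r = 0 by lia]
    have : (n : ℤ) ≤ r := by exact_mod_cast h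
    push_cast
    nlinarith

/-! ### Coroot pairings and the final comparison of exponents -/

lemma corootPairing_negLong (n r : ℕ) :
    corootPairing ((n : ℚ) • weightΛ + weightΛ₀) (RealRoot.negLong r).weight = r - n := by
  simp [corootPairing, stdForm, RealRoot.weight, rootα, rootδ, weightΛ, weightΛ₀]
  ring

lemma corootPairing_negHalf (n r : ℕ) :
    corootPairing ((n : ℚ) • weightΛ + weightΛ₀) (RealRoot.negHalf r).weight =
      2 * r + 1 - 2 * n := by
  simp [corootPairing, stdForm, RealRoot.weight, rootα, rootδ, weightΛ, weightΛ₀]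
  ring

lemma weight_apply_zero_of_mem_negRealRoots {μ : AffineWeight} (h : μ ∈ negRealRoots) :
    μ 0 < 0 := by
  rcases h with ⟨r, rfl⟩ | ⟨r, rfl⟩ <;> simp [rootα, rootδ]

end TwistedA22

theorem proposition8p6 (n : ℕ) :
    (∀ β : TwistedA22.RealRoot,
      β.weight ∈ TwistedA22.negRealRoots \ TwistedA22.finiteNegRoots →
        ∃ k : ℕ,
          (k : ℚ) = max 0 (-TwistedA22.corootPairing
            ((n : ℚ) • TwistedA22.weightΛ + TwistedA22.weightΛ₀) β.weight) ∧
          TwistedA22.toU (TwistedA22.rootVector β) ^ (k + 1) • TwistedA22.weylVector n = 0) ∧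
    (∀ k : ℕ, k < n →
      TwistedA22.toU (TwistedA22.rootVector (.negHalf k)) ^ (2 * n - 2 * k) •
        TwistedA22.weylVector n = 0) ∧
    (∀ k : ℕ, n ≤ k →
      TwistedA22.toU (TwistedA22.rootVector (.negHalf k)) • TwistedA22.weylVector n = 0) := by
  refine ⟨?_, fun k hk => TwistedA22.negHalf_pow_smul_weylVector hk,
    fun k hk => TwistedA22.negHalf_smul_weylVector hk⟩
  rintro β ⟨hneg, hfin⟩
  cases β with
  | posLong r =>
    have := TwistedA22.weight_apply_zero_of_mem_negRealRoots hneg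
    norm_num [TwistedA22.RealRoot.weight, TwistedA22.rootα, TwistedA22.rootδ] at this
  | posHalf r =>
    have := TwistedA22.weight_apply_zero_of_mem_negRealRoots hneg
    norm_num [TwistedA22.RealRoot.weight, TwistedA22.rootα, TwistedA22.rootδ] at this
  | negLong r =>
    have hr : 1 ≤ r := by
      by_contra h
      obtain rfl : r = 0 := by lia
      exact hfin (by simp [TwistedA22.RealRoot.weight, TwistedA22.finiteNegRoots])
    -- Truncated subtraction is the maximum of 0 and n - r.
    refine ⟨n - r, ?_, TwistedA22.negLong_pow_smul_weylVector hr⟩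
    rw [TwistedA22.corootPairing_negLong]
    rcases le_total r n with h | h
    · have h' : (r : ℚ) ≤ n := by exact_mod_cast h
      rw [max_eq_right (by linarith), Nat.cast_sub h]
      ring
    · have h' : (n : ℚ) ≤ r := by exact_mod_cast h
      rw [max_eq_left (by linarith), Nat.sub_eq_zero_of_le h, Nat.cast_zero]
  | negHalf r =>
    rw [TwistedA22.corootPairing_negHalf]
    rcases lt_or_ge r n with h | h
    · refine ⟨2 * n - 2 * r - 1, ?_, ?_⟩
      · have h' : (r : ℚ) + 1 ≤ n := by exact_mod_cast h
        rw [max_eq_right (by linarith), Nat.cast_sub (by lia), Nat.cast_sub (by lia)]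
        push_cast
        ring
      · rw [show 2 * n - 2 * r - 1 + 1 = 2 * n - 2 * r by lia]
        exact TwistedA22.negHalf_pow_smul_weylVector h
    · have h' : (n : ℚ) ≤ r := by exact_mod_cast h
      refine ⟨0, ?_, ?_⟩
      · rw [max_eq_left (by linarith), Nat.cast_zero]
      · rw [zero_add, pow_one]
        exact TwistedA22.negHalf_smul_weylVector h
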